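/- Let $k$ be a field of characteristic zero and $V$ a $k$-vector space. Let $TV$ be the tensor algebra and $LV\subset TV$ the Lie subalgebra generated by $V$ (the free Lie algebra on $V$), graded by $L_0=V$, $L_{n+1}=[L_0,L_n]$. Let $\mathrm{Poiss}\,V=S(LV)$ be the symmetric algebra of $LV$, with the Poisson bracket induced by the Lie bracket of $LV$ (the free Poisson algebra on $V$), and let $S_n(LV)\subset S(LV)$ be the span of the products $l_1\cdots l_r$ $(r\ge 0)$ with $l_i\in L_{d_i}$ and $d_1+\dots+d_r=n$. For an associative unital $k$-algebra $R$ let the commutator filtration be defined by $$F_0R=R,\qquad F_{n+1}R=\sum_{p=1}^{n}F_pR\cdot F_{n+1-p}R+\sum_{p=0}^{n}\langle[F_pR,F_{n-p}R]\rangle ,$$ where $\langle Y\rangle$ denotes the two-sided ideal generated by $Y$. Its associated graded $\bigoplus_n F_nR/F_{n+1}R$ is a commutative algebra, and a Poisson algebra with the bracket $F_pR/F_{p+1}R\times F_qR/F_{q+1}R\to F_{p+q+1}R/F_{p+q+2}R$ induced by the commutator of $R$. Then there is a unique homomorphism of Poisson algebras (the natural map) $$\mathrm{Poiss}\,V\longrightarrow\bigoplus_{n=0}^{\infty}F_nTV/F_{n+1}TV$$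 which sends each $v\in V$ to its class in $F_0TV/F_1TV$. It is an isomorphism, and it maps $S_n(LV)$ onto $F_nTV/F_{n+1}TV$ for every $n\ge 0$. It is induced by symmetrization: for $l_i\in L_{d_i}$ $(1\le i\le r)$ and $n=d_1+\dots+d_r$, the element $\frac1{r!}\sum_{\sigma\in\mathfrak S_r}l_{\sigma(1)}\cdots l_{\sigma(r)}$ of $TV$ lies in $F_nTV$, and its class in $F_nTV/F_{n+1}TV$ is the image of the product $l_1\cdots l_r$. -/

import Mathlib

namespace CommutatorFiltration

open scoped DirectSum

/-! ### Poisson algebras -/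

/-- A Poisson algebra over `k`: a commutative associative unital `k`-algebra `P` with a `k`-bilinear
bracket which makes it a Lie algebra and which is a derivation in its second (hence, by
antisymmetry, also in its first) argument. -/
class PoissonAlgebra (k P : Type*) [CommRing k] [CommRing P] [Algebra k P] where
  /-- The Poisson bracket. -/
  bracket : P →ₗ[k] P →ₗ[k] P
  bracket_self : ∀ a, bracket a a = 0
  jacobi : ∀ a b c, bracket a (bracket b c) = bracket (bracket a b) c + bracket b (bracket a c)
  leibniz : ∀ a b c, bracket a (b * c) = bracket a b * c + b * bracket a c

/-- A homomorphism of `k`-algebras between Poisson algebras is a homomorphism of Poisson algebras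
if it respects the brackets. -/
def IsPoissonHom {k P Q : Type*} [CommRing k] [CommRing P] [Algebra k P] [PoissonAlgebra k P]
    [CommRing Q] [Algebra k Q] [PoissonAlgebra k Q] (f : P →ₐ[k] Q) : Prop :=
  ∀ a b, f (PoissonAlgebra.bracket (k := k) a b) = PoissonAlgebra.bracket (k := k) (f a) (f b)

/-! ### The Poisson algebra structure on the symmetric algebra of a Lie algebra -/

section Symmetric

variable (k : Type*) [CommRing k]

section Derivation

variable {g : Type*} [AddCommGroup g] [Module k g]

/-- Auxiliary algebra homomorphism `a ↦ a + ε D(a)`, where `D` is the derivation of the symmetric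
algebra which extends the linear map `f`. -/
noncomputable def symDerivAux (f : g →ₗ[k] SymmetricAlgebra k g) :
    SymmetricAlgebra k g →ₐ[k] TrivSqZeroExt (SymmetricAlgebra k g) (SymmetricAlgebra k g) :=
  SymmetricAlgebra.lift
    ((TrivSqZeroExt.inlAlgHom k (SymmetricAlgebra k g) (SymmetricAlgebra k g)).toLinearMap ∘ₗ
        SymmetricAlgebra.ι k g +
      (TrivSqZeroExt.inrHom (SymmetricAlgebra k g) (SymmetricAlgebra k g)).restrictScalars k ∘ₗ f)

theorem fst_symDerivAux (f : g →ₗ[k] SymmetricAlgebra k g) (a : SymmetricAlgebra k g) :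
    (symDerivAux k f a).fst = a := by
  have h : (TrivSqZeroExt.fstHom k (SymmetricAlgebra k g) (SymmetricAlgebra k g)).comp
      (symDerivAux k f) = AlgHom.id k _ := by
    apply SymmetricAlgebra.algHom_ext
    ext x
    simp [symDerivAux]
  exact DFunLike.congr_fun h a

/-- The derivation of the symmetric algebra which extends the linear map `f`. -/
noncomputable def symDeriv (f : g →ₗ[k] SymmetricAlgebra k g) :
    Derivation k (SymmetricAlgebra k g) (SymmetricAlgebra k g) :=
  Derivation.mk'
    ((TrivSqZeroExt.sndHom (SymmetricAlgebra k g) (SymmetricAlgebra k g)).restrictScalars k ∘ₗ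
      (symDerivAux k f).toLinearMap)
    (by
      intro a b
      simp [fst_symDerivAux, mul_comm])

theorem symDeriv_ι (f : g →ₗ[k] SymmetricAlgebra k g) (x : g) :
    symDeriv k f (SymmetricAlgebra.ι k g x) = f x := by
  simp [symDeriv, symDerivAux]

theorem symDeriv_ext {D E : Derivation k (SymmetricAlgebra k g) (SymmetricAlgebra k g)}
    (h : ∀ x, D (SymmetricAlgebra.ι k g x) = E (SymmetricAlgebra.ι k g x)) : D = E := by
  ext a
  induction a using SymmetricAlgebra.induction with
  | algebraMap r => simp
  | ι x => exact h x
  | mul a b ha hb => simp [ha, hb]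
  | add a b ha hb => simp [ha, hb]

end Derivation

variable (g : Type*) [LieRing g] [LieAlgebra k g]

/-- The derivation `{x, -}` for `x` in the Lie algebra: it sends `y` in the Lie algebra
to `[x, y]`. -/
noncomputable def symAd :
    g →ₗ[k] Derivation k (SymmetricAlgebra k g) (SymmetricAlgebra k g) where
  toFun x := symDeriv k (SymmetricAlgebra.ι k g ∘ₗ (LieAlgebra.ad k g x : g →ₗ[k] g))
  map_add' x y := symDeriv_ext k fun z => by simp [symDeriv_ι]
  map_smul' r x := symDeriv_ext k fun z => by simp [symDeriv_ι]

/-- For `b` in the symmetric algebra, the linear map `x ↦ {x, b}` on the Lie algebra. -/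
noncomputable def symAdFlip (b : SymmetricAlgebra k g) : g →ₗ[k] SymmetricAlgebra k g where
  toFun x := symAd k g x b
  map_add' x y := by simp
  map_smul' r x := by simp

/-- The bracket of the symmetric algebra `S g`: the unique biderivation with `{x, y} = [x, y]` for
`x` and `y` in `g`. -/
noncomputable def symBracket :
    SymmetricAlgebra k g →ₗ[k] SymmetricAlgebra k g →ₗ[k] SymmetricAlgebra k g :=
  LinearMap.mk₂ k (fun a b => symDeriv k (symAdFlip k g b) a)
    (fun a b c => by simp)
    (fun r a b => by simp)
    (fun a b c => by
      have : symDeriv k (symAdFlip k g (b + c)) =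
          symDeriv k (symAdFlip k g b) + symDeriv k (symAdFlip k g c) :=
        symDeriv_ext k fun x => by simp [symDeriv_ι, symAdFlip]
      simp [this])
    (fun r a b => by
      have : symDeriv k (symAdFlip k g (r • b)) = r • symDeriv k (symAdFlip k g b) :=
        symDeriv_ext k fun x => by simp [symDeriv_ι, symAdFlip]
      simp [this])

theorem symBracket_ι (x y : g) :
    symBracket k g (SymmetricAlgebra.ι k g x) (SymmetricAlgebra.ι k g y) =
      SymmetricAlgebra.ι k g ⁅x, y⁆ := by
  simp [symBracket, symDeriv_ι, symAdFlip, symAd]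

theorem symBracket_mul_left (a b c : SymmetricAlgebra k g) :
    symBracket k g (a * b) c = a * symBracket k g b c + b * symBracket k g a c := by
  simp [symBracket]

theorem symBracket_mul_right (a b c : SymmetricAlgebra k g) :
    symBracket k g a (b * c) = symBracket k g a b * c + b * symBracket k g a c := by
  have : symDeriv k (symAdFlip k g (b * c)) =
      c • symDeriv k (symAdFlip k g b) + b • symDeriv k (symAdFlip k g c) :=
    symDeriv_ext k fun x => by simp [symDeriv_ι, symAdFlip, add_comm]
  simp [symBracket, this, mul_comm]

theorem symBracket_algebraMap_left (r : k) (a : SymmetricAlgebra k g) :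
    symBracket k g (algebraMap k _ r) a = 0 := by
  simp [symBracket]

theorem symBracket_algebraMap_right (r : k) (a : SymmetricAlgebra k g) :
    symBracket k g a (algebraMap k _ r) = 0 := by
  have : symDeriv k (symAdFlip k g (algebraMap k _ r)) = 0 :=
    symDeriv_ext k fun x => by simp [symDeriv_ι, symAdFlip]
  simp [symBracket, this]

theorem symBracket_skew (a b : SymmetricAlgebra k g) :
    symBracket k g a b = - symBracket k g b a := by
  induction a using SymmetricAlgebra.induction with
  | algebraMap r => simp [symBracket_algebraMap_left, symBracket_algebraMap_right]
  | mul a c ha hc => rw [symBracket_mul_left, symBracket_mul_right, ha, hc]; ring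
  | add a c ha hc => simp only [map_add, LinearMap.add_apply, ha, hc]; ring
  | ι x =>
    induction b using SymmetricAlgebra.induction with
    | algebraMap r => simp [symBracket_algebraMap_left, symBracket_algebraMap_right]
    | mul a c ha hc => rw [symBracket_mul_left, symBracket_mul_right, ha, hc]; ring
    | add a c ha hc => simp only [map_add, LinearMap.add_apply, ha, hc]; ring
    | ι y => rw [symBracket_ι, symBracket_ι, ← map_neg, lie_skew]

theorem symBracket_self (a : SymmetricAlgebra k g) : symBracket k g a a = 0 := by
  induction a using SymmetricAlgebra.induction with
  | algebraMap r => simp [symBracket_algebraMap_left]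
  | ι x => rw [symBracket_ι, lie_self, (SymmetricAlgebra.ι k g).map_zero]
  | mul a b ha hb =>
    rw [symBracket_mul_left, symBracket_mul_right, symBracket_mul_right, ha, hb,
      symBracket_skew k g b a]
    ring
  | add a b ha hb =>
    simp only [map_add, LinearMap.add_apply, ha, hb]
    rw [symBracket_skew k g b a]
    ring

theorem symBracket_jacobi (a b c : SymmetricAlgebra k g) :
    symBracket k g a (symBracket k g b c) =
      symBracket k g (symBracket k g a b) c + symBracket k g b (symBracket k g a c) := by
  induction a using SymmetricAlgebra.induction with
  | algebraMap r => simp [symBracket_algebraMap_left]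
  | mul a d ha hd =>
    simp only [symBracket_mul_left, symBracket_mul_right, map_add, LinearMap.add_apply, ha, hd]
    rw [symBracket_skew k g b a, symBracket_skew k g b d]
    ring
  | add a d ha hd =>
    simp only [map_add, LinearMap.add_apply, ha, hd]
    ring
  | ι x =>
    induction b using SymmetricAlgebra.induction with
    | algebraMap r => simp [symBracket_algebraMap_left, symBracket_algebraMap_right]
    | mul a d ha hd =>
      simp only [symBracket_mul_left, symBracket_mul_right, map_add, LinearMap.add_apply, ha, hd]
      ring
    | add a d ha hd =>
      simp only [map_add, LinearMap.add_apply, ha, hd]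
      ring
    | ι y =>
      induction c using SymmetricAlgebra.induction with
      | algebraMap r => simp only [symBracket_algebraMap_right, map_zero, add_zero]
      | mul a d ha hd =>
        simp only [symBracket_mul_right, map_add, ha, hd]
        ring
      | add a d ha hd =>
        simp only [map_add, ha, hd]
        ring
      | ι z => simp only [symBracket_ι]; rw [← map_add, ← leibniz_lie]

noncomputable instance : PoissonAlgebra k (SymmetricAlgebra k g) where
  bracket := symBracket k g
  bracket_self := symBracket_self k g
  jacobi := symBracket_jacobi k g
  leibniz := symBracket_mul_right k g

end Symmetric

/-! ### The commutator filtration of an associative algebra -/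

section Filtration

variable (k : Type*) [CommRing k] (R : Type*) [Ring R] [Algebra k R]

/-- The commutator filtration of `R`: `F 0 = R`, and
`F (n + 1) = ∑_{p = 1}^{n} F p * F (n + 1 - p) + ∑_{p = 0}^{n} ⟨[F p, F (n - p)]⟩`,
where `⟨Y⟩` is the two-sided ideal generated by `Y`, that is, the `k`-span of the products
`r * y * s` with `r`, `s` in `R` and `y` in `Y`.
In the first sum `p = i + 1` and `n + 1 - p = n - i`. -/
def commFil : ℕ → Submodule k R
  | 0 => ⊤
  | n + 1 =>
    (⨆ i : Fin n, commFil (i + 1) * commFil (n - i)) ⊔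
      ⨆ p : Fin (n + 1),
        ⊤ * Submodule.span k {x | ∃ a ∈ commFil p, ∃ b ∈ commFil (n - p), x = ⁅a, b⁆} * ⊤
  termination_by n => n
  decreasing_by all_goals omega

theorem commFil_zero : commFil k R 0 = ⊤ := by
  rw [commFil]

variable {k R}

theorem mul_mem_commFil_succ {p q : ℕ} {a b : R} (ha : a ∈ commFil k R (p + 1))
    (hb : b ∈ commFil k R (q + 1)) : a * b ∈ commFil k R (p + 1 + (q + 1)) := by
  have e : p + 1 + (q + 1) = (p + 1 + q) + 1 := by omega
  rw [e, commFil]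
  apply Submodule.mem_sup_left
  apply Submodule.mem_iSup_of_mem (⟨p, by omega⟩ : Fin (p + 1 + q))
  have e' : p + 1 + q - p = q + 1 := by omega
  simp only [e']
  exact Submodule.mul_mem_mul ha hb

theorem lie_mem_commFil {p q : ℕ} {a b : R} (ha : a ∈ commFil k R p)
    (hb : b ∈ commFil k R q) : a * b - b * a ∈ commFil k R (p + q + 1) := by
  rw [commFil]
  apply Submodule.mem_sup_right
  apply Submodule.mem_iSup_of_mem (⟨p, by omega⟩ : Fin (p + q + 1))
  have e' : p + q - p = q := by omega
  simp only [e']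
  have h : ⁅a, b⁆ ∈ Submodule.span k
      {x | ∃ a ∈ commFil k R p, ∃ b ∈ commFil k R q, x = ⁅a, b⁆} :=
    Submodule.subset_span ⟨a, ha, b, hb, rfl⟩
  have := Submodule.mul_mem_mul (Submodule.mul_mem_mul
    (Submodule.mem_top (R := k) (x := (1 : R))) h) (Submodule.mem_top (R := k) (x := (1 : R)))
  simpa [Ring.lie_def] using this

theorem commFil_ideal (n : ℕ) :
    ⊤ * commFil k R n ≤ commFil k R n ∧ commFil k R n * ⊤ ≤ commFil k R n := by
  have tt : (⊤ : Submodule k R) * ⊤ ≤ ⊤ := le_top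
  induction n using Nat.strong_induction_on with
  | _ n ih =>
    cases n with
    | zero => simp [commFil_zero]
    | succ n =>
      rw [commFil]
      constructor
      · rw [Submodule.mul_sup, Submodule.mul_iSup, Submodule.mul_iSup]
        apply sup_le_sup <;> apply iSup_mono
        · intro i
          rw [← mul_assoc]
          exact mul_le_mul' (ih _ (by omega)).1 le_rfl
        · intro p
          rw [← mul_assoc, ← mul_assoc]
          exact mul_le_mul' (mul_le_mul' tt le_rfl) le_rfl
      · rw [Submodule.sup_mul, Submodule.iSup_mul, Submodule.iSup_mul]
        apply sup_le_sup <;> apply iSup_mono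
        · intro i
          rw [mul_assoc]
          exact mul_le_mul' le_rfl (ih _ (by omega)).2
        · intro p
          rw [mul_assoc]
          exact mul_le_mul' le_rfl tt

theorem mul_mem_commFil {p q : ℕ} {a b : R} (ha : a ∈ commFil k R p)
    (hb : b ∈ commFil k R q) : a * b ∈ commFil k R (p + q) := by
  cases p with
  | zero =>
    rw [Nat.zero_add]
    exact (commFil_ideal q).1 (Submodule.mul_mem_mul Submodule.mem_top hb)
  | succ p =>
    cases q with
    | zero => exact (commFil_ideal (p + 1)).2 (Submodule.mul_mem_mul ha Submodule.mem_top)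
    | succ q => exact mul_mem_commFil_succ ha hb

theorem commFil_succ_le (n : ℕ) : commFil k R (n + 1) ≤ commFil k R n := by
  induction n using Nat.strong_induction_on with
  | _ n ih =>
    cases n with
    | zero => simp [commFil_zero]
    | succ n =>
      rw [commFil]
      apply sup_le <;> apply iSup_le
      · intro i
        rw [Submodule.mul_le]
        intro a ha b hb
        have := mul_mem_commFil (ih i (by omega) ha) hb
        have e : (i : ℕ) + (n + 1 - i) = n + 1 := by omega
        rwa [e] at this
      · intro p
        refine le_trans (mul_le_mul' (mul_le_mul' le_rfl
          (show _ ≤ commFil k R (n + 1) from Submodule.span_le.2 ?_)) le_rfl)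
          (le_trans (mul_le_mul' (commFil_ideal _).1 le_rfl) (commFil_ideal _).2)
        rintro x ⟨a, ha, b, hb, rfl⟩
        rw [SetLike.mem_coe, Ring.lie_def]
        obtain ⟨p, hp⟩ := p
        cases p with
        | zero =>
          have := lie_mem_commFil ha (ih n (by omega) hb)
          simpa using this
        | succ p =>
          have := lie_mem_commFil (ih p (by omega) ha) hb
          simp only at this
          have e : p + (n + 1 - (p + 1)) + 1 = n + 1 := by omega
          rwa [e] at this

variable (k R)

/-! ### The associated graded Poisson algebra -/

/-- The quotient `F n / F (n + 1)`. -/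
def GrPiece (n : ℕ) : Type _ :=
  ↥(commFil k R n) ⧸ (commFil k R (n + 1)).submoduleOf (commFil k R n)

instance (n : ℕ) : AddCommGroup (GrPiece k R n) :=
  inferInstanceAs (AddCommGroup
    (↥(commFil k R n) ⧸ (commFil k R (n + 1)).submoduleOf (commFil k R n)))

instance (n : ℕ) : Module k (GrPiece k R n) :=
  inferInstanceAs (Module k
    (↥(commFil k R n) ⧸ (commFil k R (n + 1)).submoduleOf (commFil k R n)))

/-- The class in `F n / F (n + 1)` of an element of `F n`. -/
def grMk (n : ℕ) : ↥(commFil k R n) →ₗ[k] GrPiece k R n :=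
  Submodule.mkQ ((commFil k R (n + 1)).submoduleOf (commFil k R n))

variable {k R}

theorem grMk_eq {n : ℕ} {a b : R} (ha : a ∈ commFil k R n) (hb : b ∈ commFil k R n)
    (h : a - b ∈ commFil k R (n + 1)) : grMk k R n ⟨a, ha⟩ = grMk k R n ⟨b, hb⟩ := by
  exact (Submodule.Quotient.eq _).2 h

theorem grMk_eq_zero {n : ℕ} {a : R} (ha : a ∈ commFil k R n)
    (h : a ∈ commFil k R (n + 1)) : grMk k R n ⟨a, ha⟩ = 0 := by
  exact (Submodule.Quotient.mk_eq_zero _).2 h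

/-- A bilinear map which vanishes on `p` and on `q` descends to the quotients. -/
def bilinQ {M N P : Type*} [AddCommGroup M] [Module k M] [AddCommGroup N] [Module k N]
    [AddCommGroup P] [Module k P] (B : M →ₗ[k] N →ₗ[k] P) (p : Submodule k M) (q : Submodule k N)
    (hp : ∀ m ∈ p, ∀ n, B m n = 0) (hq : ∀ m, ∀ n ∈ q, B m n = 0) :
    M ⧸ p →ₗ[k] N ⧸ q →ₗ[k] P :=
  p.liftQ (LinearMap.flip (q.liftQ B.flip
      (fun n hn => LinearMap.ext fun m => by simpa using hq m n hn)))
    (fun m hm => by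
      refine LinearMap.ext fun x => ?_
      obtain ⟨n, rfl⟩ := Submodule.mkQ_surjective q x
      exact hp m hm n)

/-- The product `F i / F (i + 1) × F j / F (j + 1) → F (i + j) / F (i + j + 1)` induced by the
product of `R`. -/
def grMul (i j : ℕ) : GrPiece k R i →ₗ[k] GrPiece k R j →ₗ[k] GrPiece k R (i + j) :=
  bilinQ
    (LinearMap.mk₂ k
      (fun (a : ↥(commFil k R i)) (b : ↥(commFil k R j)) =>
        grMk k R (i + j) ⟨(a : R) * b, mul_mem_commFil a.2 b.2⟩)
      (fun a b c => by rw [← map_add]; congr 1; ext; simp [add_mul])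
      (fun r a b => by rw [← map_smul]; congr 1; ext; simp)
      (fun a b c => by rw [← map_add]; congr 1; ext; simp [mul_add])
      (fun r a b => by rw [← map_smul]; congr 1; ext; simp))
    _ _
    (fun a ha b => by
      apply grMk_eq_zero
      have := mul_mem_commFil (k := k) (p := i + 1) (q := j) ha b.2
      have e : i + 1 + j = i + j + 1 := by omega
      rwa [e] at this)
    (fun a b hb => by
      apply grMk_eq_zero
      exact mul_mem_commFil (k := k) (p := i) (q := j + 1) a.2 hb)

theorem grMul_mk {i j : ℕ} {a b : R} (ha : a ∈ commFil k R i) (hb : b ∈ commFil k R j) :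
    grMul i j (grMk k R i ⟨a, ha⟩) (grMk k R j ⟨b, hb⟩) =
      grMk k R (i + j) ⟨a * b, mul_mem_commFil ha hb⟩ :=
  rfl

/-- The bracket `F i / F (i + 1) × F j / F (j + 1) → F (i + j + 1) / F (i + j + 2)` induced by the
commutator of `R`. -/
def grBracket (i j : ℕ) : GrPiece k R i →ₗ[k] GrPiece k R j →ₗ[k] GrPiece k R (i + j + 1) :=
  bilinQ
    (LinearMap.mk₂ k
      (fun (a : ↥(commFil k R i)) (b : ↥(commFil k R j)) =>
        grMk k R (i + j + 1) ⟨(a : R) * b - b * a, lie_mem_commFil a.2 b.2⟩)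
      (fun a b c => by
        rw [← map_add]; congr 1; ext
        simp only [Submodule.coe_add, add_mul, mul_add]; abel)
      (fun r a b => by rw [← map_smul]; congr 1; ext; simp [smul_sub])
      (fun a b c => by
        rw [← map_add]; congr 1; ext
        simp only [Submodule.coe_add, add_mul, mul_add]; abel)
      (fun r a b => by rw [← map_smul]; congr 1; ext; simp [smul_sub]))
    _ _
    (fun a ha b => by
      apply grMk_eq_zero
      have := lie_mem_commFil (k := k) (p := i + 1) (q := j) ha b.2
      have e : i + 1 + j + 1 = i + j + 1 + 1 := by omega
      rwa [e] at this)
    (fun a b hb => by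
      apply grMk_eq_zero
      exact lie_mem_commFil (k := k) (p := i) (q := j + 1) a.2 hb)

theorem grBracket_mk {i j : ℕ} {a b : R} (ha : a ∈ commFil k R i) (hb : b ∈ commFil k R j) :
    grBracket i j (grMk k R i ⟨a, ha⟩) (grMk k R j ⟨b, hb⟩) =
      grMk k R (i + j + 1) ⟨a * b - b * a, lie_mem_commFil ha hb⟩ :=
  rfl

theorem mem_commFil_zero (a : R) : a ∈ commFil k R 0 := by
  rw [commFil_zero]; exact Submodule.mem_top

theorem one_mem_commFil : (1 : R) ∈ commFil k R 0 := by
  rw [commFil_zero]; exact Submodule.mem_top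

theorem gradedMonoid_mk_eq {i j : ℕ} (h : i = j) {a b : R} (ha : a ∈ commFil k R i)
    (hb : b ∈ commFil k R j) (hab : a = b) :
    GradedMonoid.mk (A := GrPiece k R) i (grMk k R i ⟨a, ha⟩) =
      GradedMonoid.mk j (grMk k R j ⟨b, hb⟩) := by
  subst h hab
  rfl

theorem grMk_surj {n : ℕ} (x : GrPiece k R n) : ∃ a, ∃ ha : a ∈ commFil k R n,
    x = grMk k R n ⟨a, ha⟩ := by
  obtain ⟨⟨a, ha⟩, rfl⟩ := Submodule.mkQ_surjective _ x
  exact ⟨a, ha, rfl⟩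

instance grGOne : GradedMonoid.GOne (GrPiece k R) where
  one := grMk k R 0 ⟨1, one_mem_commFil⟩

instance grGMul : GradedMonoid.GMul (GrPiece k R) where
  mul {i j} a b := grMul i j a b

instance grGMonoid : GradedMonoid.GMonoid (GrPiece k R) where
  one_mul := by
    rintro ⟨i, x⟩
    obtain ⟨a, ha, rfl⟩ := grMk_surj x
    exact gradedMonoid_mk_eq (zero_add i) _ _ (one_mul a)
  mul_one := by
    rintro ⟨i, x⟩
    obtain ⟨a, ha, rfl⟩ := grMk_surj x
    exact gradedMonoid_mk_eq (add_zero i) _ _ (mul_one a)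
  mul_assoc := by
    rintro ⟨i, x⟩ ⟨j, y⟩ ⟨l, z⟩
    obtain ⟨a, ha, rfl⟩ := grMk_surj x
    obtain ⟨b, hb, rfl⟩ := grMk_surj y
    obtain ⟨c, hc, rfl⟩ := grMk_surj z
    exact gradedMonoid_mk_eq (add_assoc i j l) _ _ (mul_assoc a b c)

instance grGCommRing : DirectSum.GCommRing (GrPiece k R) where
  __ := grGMonoid
  mul_zero {i j} a := map_zero (grMul i j a)
  zero_mul {i j} b := LinearMap.congr_fun (map_zero (grMul i j)) b
  mul_add {i j} a b c := map_add (grMul i j a) b c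
  add_mul {i j} a b c := LinearMap.congr_fun (map_add (grMul i j) a b) c
  mul_comm := by
    rintro ⟨i, x⟩ ⟨j, y⟩
    obtain ⟨a, ha, rfl⟩ := grMk_surj x
    obtain ⟨b, hb, rfl⟩ := grMk_surj y
    have h : grMk k R (i + j) ⟨a * b, mul_mem_commFil ha hb⟩ =
        grMk k R (i + j) ⟨b * a, (add_comm j i) ▸ mul_mem_commFil hb ha⟩ :=
      grMk_eq _ _ (lie_mem_commFil ha hb)
    refine Eq.trans (congrArg (GradedMonoid.mk (i + j)) h) ?_
    exact gradedMonoid_mk_eq (add_comm i j) _ _ rfl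
  natCast n := n • grMk k R 0 ⟨1, one_mem_commFil⟩
  natCast_zero := zero_smul _ _
  natCast_succ n := succ_nsmul _ _
  intCast n := n • grMk k R 0 ⟨1, one_mem_commFil⟩
  intCast_ofNat n := natCast_zsmul _ _
  intCast_negSucc_ofNat n := negSucc_zsmul _ _

instance grGAlgebra : DirectSum.GAlgebra k (GrPiece k R) where
  toFun :=
    { toFun := fun r => r • grMk k R 0 ⟨1, one_mem_commFil⟩
      map_zero' := zero_smul _ _
      map_add' := fun r s => add_smul _ _ _ }
  map_one := one_smul _ _
  map_mul r s := gradedMonoid_mk_eq (a := (r * s) • (1 : R)) (b := (r • (1 : R)) * (s • (1 : R)))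
    (zero_add 0).symm _ _ (by rw [smul_mul_smul_comm, one_mul])
  commutes := by
    rintro r ⟨i, x⟩
    obtain ⟨a, ha, rfl⟩ := grMk_surj x
    exact gradedMonoid_mk_eq (a := (r • (1 : R)) * a) (b := a * (r • (1 : R)))
      (by change 0 + i = i + 0; omega) _ _ (by simp)
  smul_def := by
    rintro r ⟨i, x⟩
    obtain ⟨a, ha, rfl⟩ := grMk_surj x
    exact gradedMonoid_mk_eq (a := r • a) (b := (r • (1 : R)) * a)
      (by change i = 0 + i; omega) _ _ (by simp)

variable (k R)

/-- The associated graded algebra `⨁ F n / F (n + 1)` of the commutator filtration. -/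
abbrev Gr : Type _ := ⨁ n, GrPiece k R n

/-- The class of an element of `F n`, placed in degree `n` of the associated graded algebra. -/
def symb (n : ℕ) : ↥(commFil k R n) →ₗ[k] Gr k R :=
  DirectSum.lof k ℕ (GrPiece k R) n ∘ₗ grMk k R n

/-- The bracket of the associated graded algebra, which on classes of elements is
`{[a], [b]} = [a * b - b * a]`, raising the total degree by one. -/
def grLie : Gr k R →ₗ[k] Gr k R →ₗ[k] Gr k R :=
  DirectSum.toModule k ℕ _ fun i => LinearMap.flip <|
    DirectSum.toModule k ℕ _ fun j => LinearMap.flip <|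
      (grBracket i j).compr₂ (DirectSum.lof k ℕ (GrPiece k R) (i + j + 1))

variable {k R}

theorem symb_congr {i j : ℕ} (h : i = j) {a b : R} (ha : a ∈ commFil k R i)
    (hb : b ∈ commFil k R j) (hab : a = b) : symb k R i ⟨a, ha⟩ = symb k R j ⟨b, hb⟩ := by
  subst h hab
  rfl

theorem symb_mul {i j : ℕ} {a b : R} (ha : a ∈ commFil k R i) (hb : b ∈ commFil k R j) :
    symb k R i ⟨a, ha⟩ * symb k R j ⟨b, hb⟩ = symb k R (i + j) ⟨a * b, mul_mem_commFil ha hb⟩ :=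
  DirectSum.of_mul_of _ _

theorem grLie_symb {i j : ℕ} {a b : R} (ha : a ∈ commFil k R i) (hb : b ∈ commFil k R j) :
    grLie k R (symb k R i ⟨a, ha⟩) (symb k R j ⟨b, hb⟩) =
      symb k R (i + j + 1) ⟨a * b - b * a, lie_mem_commFil ha hb⟩ := by
  simp only [grLie, symb, LinearMap.comp_apply, DirectSum.toModule_lof, LinearMap.flip_apply,
    LinearMap.compr₂_apply, grBracket_mk]

theorem gr_induction {motive : Gr k R → Prop} (zero : motive 0)
    (symb : ∀ n a (ha : a ∈ commFil k R n), motive (symb k R n ⟨a, ha⟩))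
    (add : ∀ x y, motive x → motive y → motive (x + y)) (x : Gr k R) : motive x := by
  induction x using DirectSum.induction_on with
  | zero => exact zero
  | of i x =>
    obtain ⟨a, ha, rfl⟩ := grMk_surj x
    exact symb i a ha
  | add x y hx hy => exact add x y hx hy

theorem grLie_skew (x y : Gr k R) : grLie k R x y = - grLie k R y x := by
  induction x using gr_induction with
  | zero => simp
  | add x z hx hz => simp only [map_add, LinearMap.add_apply, hx, hz]; abel
  | symb i a ha =>
    induction y using gr_induction with
    | zero => simp
    | add x z hx hz => simp only [map_add, LinearMap.add_apply, hx, hz]; abel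
    | symb j b hb =>
      rw [grLie_symb, grLie_symb, ← map_neg]
      exact symb_congr (by omega) _ (neg_mem (lie_mem_commFil hb ha)) (by simp)

theorem grLie_self (x : Gr k R) : grLie k R x x = 0 := by
  induction x using gr_induction with
  | zero => simp
  | add x z hx hz =>
    simp only [map_add, LinearMap.add_apply, hx, hz]
    rw [grLie_skew x z]
    simp
  | symb i a ha =>
    rw [grLie_symb, ← map_zero (symb k R (i + i + 1))]
    exact symb_congr rfl _ (zero_mem _) (by simp)

theorem grLie_jacobi (x y z : Gr k R) :
    grLie k R x (grLie k R y z) = grLie k R (grLie k R x y) z + grLie k R y (grLie k R x z) := by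
  induction x using gr_induction with
  | zero => simp
  | add x x' hx hx' => simp only [map_add, LinearMap.add_apply, hx, hx']; abel
  | symb i a ha =>
    induction y using gr_induction with
    | zero => simp
    | add x x' hx hx' => simp only [map_add, LinearMap.add_apply, hx, hx']; abel
    | symb j b hb =>
      induction z using gr_induction with
      | zero => simp
      | add x x' hx hx' => simp only [map_add, hx, hx']; abel
      | symb l c hc =>
        have h1 := lie_mem_commFil ha hb
        have h2 := lie_mem_commFil ha hc
        have h3 := lie_mem_commFil hb hc
        have h4 := lie_mem_commFil ha h3
        have h5 := lie_mem_commFil h1 hc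
        have h6 := lie_mem_commFil hb h2
        have e5 : i + j + 1 + l + 1 = i + (j + l + 1) + 1 := by omega
        have e6 : j + (i + l + 1) + 1 = i + (j + l + 1) + 1 := by omega
        have h5' := e5 ▸ h5
        have h6' := e6 ▸ h6
        rw [grLie_symb hb hc, grLie_symb ha hb, grLie_symb ha hc, grLie_symb ha h3,
          grLie_symb h1 hc, grLie_symb hb h2, symb_congr e5 h5 h5' rfl,
          symb_congr e6 h6 h6' rfl, ← map_add]
        exact symb_congr rfl _ (add_mem h5' h6') (by noncomm_ring)

theorem grLie_leibniz (x y z : Gr k R) :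
    grLie k R x (y * z) = grLie k R x y * z + y * grLie k R x z := by
  induction x using gr_induction with
  | zero => simp
  | add x x' hx hx' => simp only [map_add, LinearMap.add_apply, hx, hx']; ring
  | symb i a ha =>
    induction y using gr_induction with
    | zero => simp
    | add x x' hx hx' => simp only [map_add, add_mul, hx, hx']; ring
    | symb j b hb =>
      induction z using gr_induction with
      | zero => simp
      | add x x' hx hx' => simp only [map_add, mul_add, hx, hx']; ring
      | symb l c hc =>
        have h1 := lie_mem_commFil ha hb
        have h2 := lie_mem_commFil ha hc
        have h3 := mul_mem_commFil hb hc
        have h4 := lie_mem_commFil ha h3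
        have h5 := mul_mem_commFil h1 hc
        have h6 := mul_mem_commFil hb h2
        have e5 : i + j + 1 + l = i + (j + l) + 1 := by omega
        have e6 : j + (i + l + 1) = i + (j + l) + 1 := by omega
        have h5' := e5 ▸ h5
        have h6' := e6 ▸ h6
        rw [symb_mul hb hc, grLie_symb ha hb, grLie_symb ha hc, grLie_symb ha h3,
          symb_mul h1 hc, symb_mul hb h2, symb_congr e5 h5 h5' rfl,
          symb_congr e6 h6 h6' rfl, ← map_add]
        exact symb_congr rfl _ (add_mem h5' h6') (by noncomm_ring)

instance : PoissonAlgebra k (Gr k R) where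
  bracket := grLie k R
  bracket_self := grLie_self
  jacobi := grLie_jacobi
  leibniz := grLie_leibniz

end Filtration

/-! ### The free Lie algebra and the free Poisson algebra on a vector space -/

section Free

variable (k : Type*) [CommRing k] (V : Type*) [AddCommGroup V] [Module k V]

/-- The tensor algebra as a Lie algebra, the bracket being the commutator. -/
instance : LieRing (TensorAlgebra k V) := LieRing.ofAssociativeRing

/-- The Lie algebra `LV`: the Lie subalgebra generated by `V` in the tensor algebra `TV`. -/
def freeLie : LieSubalgebra k (TensorAlgebra k V) :=
  LieSubalgebra.lieSpan k (TensorAlgebra k V) (Set.range (TensorAlgebra.ι k))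

/-- The free Poisson algebra `Poiss V = S(LV)`, with the Poisson bracket induced by the Lie
bracket of `LV`. -/
abbrev Poiss : Type _ := SymmetricAlgebra k (freeLie k V)

/-- The inclusion of `LV` in `Poiss V = S(LV)`. -/
noncomputable abbrev lieToPoiss : freeLie k V →ₗ[k] Poiss k V :=
  SymmetricAlgebra.ι k (freeLie k V)

variable {V} in
/-- An element of `V`, seen in `LV`. -/
def freeLieGen (v : V) : freeLie k V :=
  ⟨TensorAlgebra.ι k v, LieSubalgebra.subset_lieSpan ⟨v, rfl⟩⟩

/-- The grading `L_0 = V`, `L_{n+1} = [L_0, L_n]` of `LV` (as subspaces of `TV`). -/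
def lieDeg : ℕ → Submodule k (TensorAlgebra k V)
  | 0 => LinearMap.range (TensorAlgebra.ι k)
  | n + 1 => Submodule.span k {x | ∃ v ∈ lieDeg 0, ∃ l ∈ lieDeg n, x = ⁅v, l⁆}

/-- The part of degree `n` of `Poiss V = S(LV)` for the grading induced by the grading of `LV`: it
is spanned by the products `l_1 ⋯ l_r` (`r ≥ 0`) with `l_i` in `L_{d_i}` and
`d_1 + ⋯ + d_r = n`. -/
def poissDeg (n : ℕ) : Submodule k (Poiss k V) :=
  Submodule.span k {x | ∃ (r : ℕ) (d : Fin r → ℕ) (l : Fin r → freeLie k V),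
    (∀ i, (l i : TensorAlgebra k V) ∈ lieDeg k V (d i)) ∧ ∑ i, d i = n ∧
      x = ∏ i, lieToPoiss k V (l i)}

end Free

/-- The symmetrized product `(1 / r!) ∑_σ a_{σ(1)} ⋯ a_{σ(r)}` of `r` elements of an algebra over
a field. -/
noncomputable def symmetrized (k : Type*) [Field k] {R : Type*} [Ring R] [Algebra k R] {r : ℕ}
    (a : Fin r → R) : R :=
  ((r.factorial : k)⁻¹) • ∑ σ : Equiv.Perm (Fin r), (List.ofFn fun i => a (σ i)).prod

end CommutatorFiltration

open CommutatorFiltration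

/-! In `TV` the commutator filtration is explicit: `F_n` is spanned by the products `l_1 ⋯ l_r` of
homogeneous Lie elements of total degree at least `n` (`commFil_tensorAlgebra`). Indeed, these spans
give all of `TV` for `n = 0`, they are multiplicative, and a commutator of two products expands by
the Leibniz rule into products in which two factors have been replaced by their bracket, which
raises the total degree by one.

Sending `l ∈ L_n` to its class in `F_n / F_{n+1}` respects brackets, so it extends to a Poisson
homomorphism on `S(LV)` (`isPoissonHom_naturalMap`). A commutative product of total degree `n` goes
to the class of the same product taken in `TV`, in any order (`LieProd.naturalMap_eq`). With the
description of `F_n` this gives surjectivity in each degree (`map_poissDeg`), and averaging over the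
orders gives the statement on symmetrization.

Injectivity takes the place of a Poincaré–Birkhoff–Witt argument. Give `TV` the coproduct with `V`
primitive and let `π : TV → LV` be a linear projection with `π 1 = 0`. Its `p`-th convolution power,
with values in `S(LV)`, kills products of fewer than `p` Lie elements (`convPow_eq_zero`) and sends
a product of `p` of them to `p!` times their commutative product (`convPow_lieProd`). A product of
length `r` and degree `m` has tensor degree `N = m + r`. Hence the map equal to `π^{*(N-n)} /
(N-n)!` in tensor degree `N` kills the products with `m > n`, where `N - n > r`, and returns the
commutative product when `m = n`. It descends to `F_n / F_{n+1}` and inverts the natural map from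
the left (`exists_leftInverse_naturalMap`). -/

namespace CommutatorFiltration

open scoped DirectSum TensorProduct

/-! ### The grading of `LV`. -/

section LieDegree

variable {k : Type*} [CommRing k] {V : Type*} [AddCommGroup V] [Module k V]

theorem lie_mem_lieDeg_succ {n : ℕ} {v l : TensorAlgebra k V} (hv : v ∈ lieDeg k V 0)
    (hl : l ∈ lieDeg k V n) : ⁅v, l⁆ ∈ lieDeg k V (n + 1) := by
  rw [lieDeg]
  exact Submodule.subset_span ⟨v, hv, l, hl, rfl⟩

/-- Induction on `p` by the Jacobi identity `[[v, l], m] = [v, [l, m]] - [l, [v, m]]`, with `q` left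
free because the last term raises it. -/
theorem lie_mem_lieDeg {p q : ℕ} {l m : TensorAlgebra k V} (hl : l ∈ lieDeg k V p)
    (hm : m ∈ lieDeg k V q) : ⁅l, m⁆ ∈ lieDeg k V (p + q + 1) := by
  induction p generalizing l m q with
  | zero => simpa using lie_mem_lieDeg_succ hl hm
  | succ p ih =>
    rw [lieDeg] at hl
    induction hl using Submodule.span_induction with
    | zero => simp
    | add x y _ _ hx hy => rw [add_lie]; exact add_mem hx hy
    | smul a x _ hx => rw [smul_lie]; exact Submodule.smul_mem _ _ hx
    | mem x h =>
      obtain ⟨v, hv, l, hl, rfl⟩ := h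
      rw [lie_lie]
      have h1 := lie_mem_lieDeg_succ hv (ih hl hm)
      have h2 := ih hl (lie_mem_lieDeg_succ hv hm)
      have e1 : p + q + 1 + 1 = p + 1 + q + 1 := by omega
      have e2 : p + (q + 1) + 1 = p + 1 + q + 1 := by omega
      exact sub_mem (e1 ▸ h1) (e2 ▸ h2)

theorem lieDeg_le_freeLie (n : ℕ) : lieDeg k V n ≤ (freeLie k V).toSubmodule := by
  induction n with
  | zero =>
    rw [lieDeg]
    rintro _ ⟨v, rfl⟩
    exact (freeLieGen k v).2
  | succ n ih =>
    rw [lieDeg, Submodule.span_le]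
    rintro _ ⟨v, hv, l, hl, rfl⟩
    rw [lieDeg] at hv
    obtain ⟨v, rfl⟩ := hv
    exact (freeLie k V).lie_mem (freeLieGen k v).2 (ih hl)

theorem lieDeg_le_commFil (n : ℕ) : lieDeg k V n ≤ commFil k (TensorAlgebra k V) n := by
  induction n with
  | zero => intro x _; exact mem_commFil_zero x
  | succ n ih =>
    rw [lieDeg, Submodule.span_le]
    rintro _ ⟨v, hv, l, hl, rfl⟩
    have := lie_mem_commFil (mem_commFil_zero (k := k) v) (ih hl)
    rwa [Nat.zero_add] at this

/-- The sum of the `L_n` contains `V` and is closed under brackets, so it contains the Lie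
subalgebra generated by `V`. -/
theorem mem_iSup_lieDeg {x : TensorAlgebra k V} (hx : x ∈ freeLie k V) :
    x ∈ ⨆ n, lieDeg k V n := by
  have key : ∀ a ∈ ⨆ n, lieDeg k V n, ∀ b ∈ ⨆ n, lieDeg k V n, ⁅a, b⁆ ∈ ⨆ n, lieDeg k V n := by
    intro a ha b hb
    refine Submodule.iSup_induction _ (motive := fun a => ⁅a, b⁆ ∈ ⨆ n, lieDeg k V n) ha
      (fun p a ha => ?_) (by simp) (fun x y hx hy => by rw [add_lie]; exact add_mem hx hy)
    exact Submodule.iSup_induction _ (motive := fun b => ⁅a, b⁆ ∈ ⨆ n, lieDeg k V n) hb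
      (fun q b hb => Submodule.mem_iSup_of_mem _ (lie_mem_lieDeg ha hb)) (by simp)
      (fun x y hx hy => by rw [lie_add]; exact add_mem hx hy)
  induction hx using LieSubalgebra.lieSpan_induction with
  | mem x h =>
    apply Submodule.mem_iSup_of_mem 0
    rw [lieDeg]
    exact h
  | zero => exact zero_mem _
  | add x y _ _ hx hy => exact add_mem hx hy
  | smul a x _ hx => exact Submodule.smul_mem _ _ hx
  | lie x y _ _ hx hy => exact key x hx y hy

/-- An additive property of elements of `LV` holds if it holds for the homogeneous elements. -/
theorem freeLie_induction {motive : freeLie k V → Prop}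
    (homogeneous : ∀ n (l : freeLie k V), (l : TensorAlgebra k V) ∈ lieDeg k V n → motive l)
    (add : ∀ x y, motive x → motive y → motive (x + y)) (l : freeLie k V) : motive l := by
  have h : ∀ x ∈ ⨆ n, lieDeg k V n, ∃ hx : x ∈ freeLie k V, motive ⟨x, hx⟩ := by
    intro x hx
    refine Submodule.iSup_induction _ (motive := fun x => ∃ hx : x ∈ freeLie k V, motive ⟨x, hx⟩)
      hx (fun n x hx => ⟨lieDeg_le_freeLie n hx, homogeneous n _ hx⟩)
      ⟨zero_mem _, homogeneous 0 _ (zero_mem _)⟩ ?_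
    rintro x y ⟨hx, hx'⟩ ⟨hy, hy'⟩
    exact ⟨add_mem hx hy, add _ _ hx' hy'⟩
  exact (h l (mem_iSup_lieDeg l.2)).2

end LieDegree

/-! ### Products of Lie elements, and the commutator filtration of `TV`. -/

section LieProd

variable (k : Type*) [CommRing k] (V : Type*) [AddCommGroup V] [Module k V]

/-- `LieProd k V r n t x` says that `t` and `x` are the products, in `TV` and in `S(LV)`, of the
same sequence of `r` homogeneous elements of `LV`, the degrees of which add up to `n`. -/
inductive LieProd : ℕ → ℕ → TensorAlgebra k V → Poiss k V → Prop
  | one : LieProd 0 0 1 1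
  | cons {d r n : ℕ} {l : freeLie k V} {t : TensorAlgebra k V} {x : Poiss k V}
      (hl : (l : TensorAlgebra k V) ∈ lieDeg k V d) (h : LieProd r n t x) :
      LieProd (r + 1) (d + n) (l * t) (lieToPoiss k V l * x)

/-- The span of the products `l_1 ⋯ l_r` in `TV` with `l_i` in `L_{d_i}` and
`n ≤ d_1 + ⋯ + d_r`. -/
def prodFil (n : ℕ) : Submodule k (TensorAlgebra k V) :=
  Submodule.span k {t | ∃ r m x, n ≤ m ∧ LieProd k V r m t x}

variable {k V}

namespace LieProd

theorem mul {r r' n n' : ℕ} {t t' : TensorAlgebra k V} {x x' : Poiss k V}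
    (h : LieProd k V r n t x) (h' : LieProd k V r' n' t' x') :
    LieProd k V (r + r') (n + n') (t * t') (x * x') := by
  induction h with
  | one => simpa using h'
  | @cons d r n l t x hl h ih =>
    have := cons hl ih
    rwa [← mul_assoc, ← mul_assoc, ← add_assoc, add_right_comm] at this

theorem of_mem_lieDeg {n : ℕ} {l : freeLie k V} (hl : (l : TensorAlgebra k V) ∈ lieDeg k V n) :
    LieProd k V 1 n l (lieToPoiss k V l) := by
  simpa using cons hl one

theorem ofFn {r : ℕ} (d : Fin r → ℕ) (l : Fin r → freeLie k V)
    (h : ∀ i, (l i : TensorAlgebra k V) ∈ lieDeg k V (d i)) :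
    LieProd k V r (∑ i, d i) (List.ofFn fun i => (l i : TensorAlgebra k V)).prod
      (∏ i, lieToPoiss k V (l i)) := by
  induction r with
  | zero => simpa using one
  | succ r ih =>
    rw [Fin.sum_univ_succ, Fin.prod_univ_succ, List.ofFn_succ, List.prod_cons]
    exact cons (h 0) (ih _ _ fun i => h i.succ)

theorem exists_fin {r n : ℕ} {t : TensorAlgebra k V} {x : Poiss k V} (h : LieProd k V r n t x) :
    ∃ (d : Fin r → ℕ) (l : Fin r → freeLie k V),
      (∀ i, (l i : TensorAlgebra k V) ∈ lieDeg k V (d i)) ∧ ∑ i, d i = n ∧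
        x = ∏ i, lieToPoiss k V (l i) := by
  induction h with
  | one => exact ⟨Fin.elim0, Fin.elim0, fun i => i.elim0, by simp, by simp⟩
  | @cons d r n l t x hl h ih =>
    obtain ⟨d', l', h', rfl, rfl⟩ := ih
    refine ⟨Fin.cons d d', Fin.cons l l', fun i => ?_, ?_, ?_⟩
    · induction i using Fin.cases with
      | zero => exact hl
      | succ i => exact h' i
    · simp [Fin.sum_univ_succ]
    · simp [Fin.prod_univ_succ]

theorem mem_poissDeg {r n : ℕ} {t : TensorAlgebra k V} {x : Poiss k V}
    (h : LieProd k V r n t x) : x ∈ poissDeg k V n := by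
  obtain ⟨d, l, h1, h2, h3⟩ := h.exists_fin
  exact Submodule.subset_span ⟨r, d, l, h1, h2, h3⟩

theorem mem_commFil {r n : ℕ} {t : TensorAlgebra k V} {x : Poiss k V}
    (h : LieProd k V r n t x) : t ∈ commFil k (TensorAlgebra k V) n := by
  induction h with
  | one => exact mem_commFil_zero 1
  | cons hl _ ih => exact mul_mem_commFil (lieDeg_le_commFil _ hl) ih

theorem mem_prodFil {r n m : ℕ} {t : TensorAlgebra k V} {x : Poiss k V}
    (h : LieProd k V r n t x) (hm : m ≤ n) : t ∈ prodFil k V m :=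
  Submodule.subset_span ⟨r, n, x, hm, h⟩

end LieProd

theorem mul_mem_prodFil {p q : ℕ} {a b : TensorAlgebra k V} (ha : a ∈ prodFil k V p)
    (hb : b ∈ prodFil k V q) : a * b ∈ prodFil k V (p + q) := by
  have h := Submodule.mul_mem_mul ha hb
  rw [prodFil, prodFil, Submodule.span_mul_span] at h
  refine Submodule.span_mono ?_ h
  rintro _ ⟨a, ⟨r, m, x, hm, ha⟩, b, ⟨r', m', x', hm', hb⟩, rfl⟩
  exact ⟨_, _, _, by omega, ha.mul hb⟩

theorem lieDeg_le_prodFil (n : ℕ) : lieDeg k V n ≤ prodFil k V n := fun l hl =>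
  (LieProd.of_mem_lieDeg (l := ⟨l, lieDeg_le_freeLie n hl⟩) hl).mem_prodFil le_rfl

theorem prodFil_zero : prodFil k V 0 = ⊤ := by
  refine eq_top_iff.2 fun t _ => ?_
  induction t using TensorAlgebra.induction with
  | algebraMap r =>
    rw [Algebra.algebraMap_eq_smul_one]
    have h : (1 : TensorAlgebra k V) ∈ prodFil k V 0 := LieProd.one.mem_prodFil le_rfl
    exact Submodule.smul_mem _ r h
  | ι v => exact lieDeg_le_prodFil 0 (by rw [lieDeg]; exact ⟨v, rfl⟩)
  | mul a b ha hb => exact mul_mem_prodFil (p := 0) (q := 0) (ha trivial) (hb trivial)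
  | add a b ha hb => exact add_mem (ha trivial) (hb trivial)

/-- The derivation `[l, -]` acts on one factor at a time, and each such bracket of homogeneous
elements gains one degree. -/
theorem LieProd.lie_mem_prodFil_of_mem_lieDeg {d r n : ℕ} {l t : TensorAlgebra k V}
    {x : Poiss k V} (hl : l ∈ lieDeg k V d) (h : LieProd k V r n t x) :
    ⁅l, t⁆ ∈ prodFil k V (d + n + 1) := by
  induction h with
  | one => simp [Ring.lie_def]
  | @cons e r n m t x hm h ih =>
    have e1 : ⁅l, (m : TensorAlgebra k V) * t⁆ = ⁅l, (m : TensorAlgebra k V)⁆ * t + m * ⁅l, t⁆ := by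
      simp only [Ring.lie_def]; noncomm_ring
    rw [e1]
    have h1 := mul_mem_prodFil (lieDeg_le_prodFil _ (lie_mem_lieDeg hl hm)) (h.mem_prodFil le_rfl)
    have h2 := mul_mem_prodFil (lieDeg_le_prodFil _ hm) ih
    have e2 : d + e + 1 + n = d + (e + n) + 1 := by omega
    have e3 : e + (d + n + 1) = d + (e + n) + 1 := by omega
    exact add_mem (e2 ▸ h1) (e3 ▸ h2)

theorem LieProd.lie_mem_prodFil {r n r' n' : ℕ} {t t' : TensorAlgebra k V}
    {x x' : Poiss k V} (h : LieProd k V r n t x) (h' : LieProd k V r' n' t' x') :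
    ⁅t, t'⁆ ∈ prodFil k V (n + n' + 1) := by
  induction h with
  | one => simp [Ring.lie_def]
  | @cons e r n m t x hm h ih =>
    have e1 : ⁅(m : TensorAlgebra k V) * t, t'⁆ = m * ⁅t, t'⁆ + ⁅(m : TensorAlgebra k V), t'⁆ * t := by
      simp only [Ring.lie_def]; noncomm_ring
    rw [e1]
    have h1 := mul_mem_prodFil (lieDeg_le_prodFil _ hm) ih
    have h2 := mul_mem_prodFil (lie_mem_prodFil_of_mem_lieDeg hm h') (h.mem_prodFil le_rfl)
    have e2 : e + (n + n' + 1) = e + n + n' + 1 := by omega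
    have e3 : e + n' + 1 + n = e + n + n' + 1 := by omega
    exact add_mem (e2 ▸ h1) (e3 ▸ h2)

theorem prodFil_antitone : Antitone (prodFil k V) := fun _ _ hpq =>
  Submodule.span_mono fun _ ⟨r, m, x, hm, h⟩ => ⟨r, m, x, hpq.trans hm, h⟩

theorem lie_mem_prodFil {p q : ℕ} {a b : TensorAlgebra k V} (ha : a ∈ prodFil k V p)
    (hb : b ∈ prodFil k V q) : ⁅a, b⁆ ∈ prodFil k V (p + q + 1) := by
  induction ha using Submodule.span_induction with
  | zero => simp
  | add x y _ _ hx hy => rw [add_lie]; exact add_mem hx hy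
  | smul c x _ hx => rw [smul_lie]; exact Submodule.smul_mem _ _ hx
  | mem x h =>
    obtain ⟨r, m, x, hm, h⟩ := h
    induction hb using Submodule.span_induction with
    | zero => simp
    | add x y _ _ hx hy => rw [lie_add]; exact add_mem hx hy
    | smul c x _ hx => rw [lie_smul]; exact Submodule.smul_mem _ _ hx
    | mem x h' =>
      obtain ⟨r', m', x, hm', h'⟩ := h'
      exact prodFil_antitone (by omega) (h.lie_mem_prodFil h')

/-- The recursion defining `commFil` produces the smallest filtration with its closure properties,
and `prodFil` has all of them. Conversely `L_d ⊆ F_d`, and `F` is multiplicative and decreasing. -/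
theorem commFil_tensorAlgebra (n : ℕ) : commFil k (TensorAlgebra k V) n = prodFil k V n := by
  apply le_antisymm
  · induction n using Nat.strong_induction_on with
    | _ n ih =>
      cases n with
      | zero => rw [prodFil_zero]; exact le_top
      | succ n =>
        rw [commFil]
        apply sup_le <;> apply iSup_le
        · intro i
          rw [Submodule.mul_le]
          intro a ha b hb
          have := mul_mem_prodFil (ih _ (by omega) ha) (ih _ (by omega) hb)
          have e : (i : ℕ) + 1 + (n - i) = n + 1 := by omega
          rwa [e] at this
        · intro p
          have hspan : Submodule.span k {x | ∃ a ∈ commFil k (TensorAlgebra k V) p,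
              ∃ b ∈ commFil k (TensorAlgebra k V) (n - p), x = ⁅a, b⁆} ≤ prodFil k V (n + 1) := by
            rw [Submodule.span_le]
            rintro x ⟨a, ha, b, hb, rfl⟩
            have := lie_mem_prodFil (ih _ (by omega) ha) (ih _ (by omega) hb)
            have e : (p : ℕ) + (n - p) + 1 = n + 1 := by omega
            rwa [e] at this
          rw [Submodule.mul_le]
          intro a ha b _
          -- Since `prodFil k V 0` is all of `TV`, multiplicativity makes each `prodFil` a two-sided
          -- ideal.
          have hb : b ∈ prodFil k V 0 := by rw [prodFil_zero]; trivial
          refine mul_mem_prodFil (q := 0) ?_ hb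
          refine Submodule.mul_le.2 ?_ ha
          intro c _ a ha
          have hc : c ∈ prodFil k V 0 := by rw [prodFil_zero]; trivial
          have := mul_mem_prodFil hc (hspan ha)
          rwa [Nat.zero_add] at this
  · refine Submodule.span_le.2 ?_
    rintro t ⟨r, m, x, hm, h⟩
    exact antitone_nat_of_succ_le (commFil_succ_le (k := k)) hm h.mem_commFil

/-- This allows a left inverse of the natural map to be checked on products only. -/
theorem span_lieProd : Submodule.span k {x | ∃ r n t, LieProd k V r n t x} = ⊤ := by
  refine eq_top_iff.2 fun x _ => ?_
  induction x using SymmetricAlgebra.induction with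
  | algebraMap r =>
    rw [Algebra.algebraMap_eq_smul_one]
    exact Submodule.smul_mem _ _ (Submodule.subset_span ⟨_, _, _, LieProd.one⟩)
  | ι l =>
    induction l using freeLie_induction with
    | homogeneous n l hl => exact Submodule.subset_span ⟨_, _, _, LieProd.of_mem_lieDeg hl⟩
    | add x y hx hy => rw [map_add]; exact add_mem (hx trivial) (hy trivial)
  | mul a b ha hb =>
    have h := Submodule.mul_mem_mul (ha trivial) (hb trivial)
    rw [Submodule.span_mul_span] at h
    refine Submodule.span_mono ?_ h
    rintro _ ⟨a, ⟨r, m, x, ha⟩, b, ⟨r', m', x', hb⟩, rfl⟩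
    exact ⟨_, _, _, ha.mul hb⟩
  | add a b ha hb => exact add_mem (ha trivial) (hb trivial)

end LieProd

/-! ### Tensor degree. -/

section Weight

variable (k : Type*) [CommRing k] (V : Type*) [AddCommGroup V] [Module k V]

/-- The algebra homomorphism `TV → TV[X]` which sends `t` of tensor degree `m` to `t X ^ m`. -/
noncomputable def weight : TensorAlgebra k V →ₐ[k] Polynomial (TensorAlgebra k V) :=
  TensorAlgebra.lift k
    ((Polynomial.monomial (R := TensorAlgebra k V) 1).restrictScalars k ∘ₗ TensorAlgebra.ι k)

variable {k V}

theorem weight_of_mem_lieDeg {n : ℕ} {l : TensorAlgebra k V} (hl : l ∈ lieDeg k V n) :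
    weight k V l = Polynomial.monomial (n + 1) l := by
  induction n generalizing l with
  | zero =>
    rw [lieDeg] at hl
    obtain ⟨v, rfl⟩ := hl
    simp [weight]
  | succ n ih =>
    rw [lieDeg] at hl
    induction hl using Submodule.span_induction with
    | zero => simp
    | add x y _ _ hx hy => rw [map_add, map_add, hx, hy]
    | smul a x _ hx => rw [map_smul, hx, Polynomial.smul_monomial]
    | mem x h =>
      obtain ⟨v, hv, l, hl, rfl⟩ := h
      have hv' : weight k V v = Polynomial.monomial 1 v := by
        rw [lieDeg] at hv
        obtain ⟨v, rfl⟩ := hv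
        simp [weight]
      rw [Ring.lie_def, map_sub, map_mul, map_mul, ih hl, hv', Polynomial.monomial_mul_monomial,
        Polynomial.monomial_mul_monomial, map_sub, add_comm 1 (n + 1)]

/-- Elements of `L_d` have tensor degree `d + 1`, so each factor contributes one more than its Lie
degree. The tensor degree thus ties the length `r` to the degree `n`. -/
theorem LieProd.weight_eq {r n : ℕ} {t : TensorAlgebra k V} {x : Poiss k V}
    (h : LieProd k V r n t x) : weight k V t = Polynomial.monomial (n + r) t := by
  induction h with
  | one => simp
  | @cons d r n l t x hl h ih =>
    rw [map_mul, ih, weight_of_mem_lieDeg hl, Polynomial.monomial_mul_monomial,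
      show d + 1 + (n + r) = d + n + (r + 1) by omega]

end Weight

/-! ### Poisson homomorphisms out of a symmetric algebra. -/

theorem bracket_algebraMap_left {k P : Type*} [CommRing k] [CommRing P] [Algebra k P]
    [PoissonAlgebra k P] (r : k) (a : P) :
    PoissonAlgebra.bracket (k := k) (algebraMap k P r) a = 0 := by
  have h1 : PoissonAlgebra.bracket (k := k) a (1 : P) = 0 := by
    simpa using PoissonAlgebra.leibniz (k := k) a 1 1
  have h2 := PoissonAlgebra.bracket_self (k := k) (a + 1)
  simp only [map_add, LinearMap.add_apply, PoissonAlgebra.bracket_self, h1, add_zero,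
    zero_add] at h2
  rw [Algebra.algebraMap_eq_smul_one, map_smul, LinearMap.smul_apply, h2, smul_zero]

theorem bracket_skew {k P : Type*} [CommRing k] [CommRing P] [Algebra k P]
    [PoissonAlgebra k P] (a b : P) :
    PoissonAlgebra.bracket (k := k) a b = -PoissonAlgebra.bracket (k := k) b a := by
  have h := PoissonAlgebra.bracket_self (k := k) (a + b)
  simp only [map_add, LinearMap.add_apply, PoissonAlgebra.bracket_self, add_zero,
    zero_add] at h
  exact eq_neg_of_add_eq_zero_right h

/-- An algebra homomorphism from `S g` to a Poisson algebra is a Poisson homomorphism if it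
respects the brackets of elements of `g`. -/
theorem isPoissonHom_of_ι {k g Q : Type*} [CommRing k] [LieRing g] [LieAlgebra k g] [CommRing Q]
    [Algebra k Q] [PoissonAlgebra k Q] (f : SymmetricAlgebra k g →ₐ[k] Q)
    (h : ∀ x y : g, f (SymmetricAlgebra.ι k g ⁅x, y⁆) =
      PoissonAlgebra.bracket (k := k) (f (SymmetricAlgebra.ι k g x))
        (f (SymmetricAlgebra.ι k g y))) : IsPoissonHom f := by
  -- With one argument in `g`, both sides are derivations along `f` in `b`, so agreement on
  -- generators suffices.
  have hr : ∀ (x : g) b, f (PoissonAlgebra.bracket (k := k) (SymmetricAlgebra.ι k g x) b) =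
      PoissonAlgebra.bracket (k := k) (f (SymmetricAlgebra.ι k g x)) (f b) := by
    intro x b
    induction b using SymmetricAlgebra.induction with
    | algebraMap r =>
      rw [bracket_skew, bracket_algebraMap_left, bracket_skew (f _), AlgHom.commutes,
        bracket_algebraMap_left, neg_zero, map_zero, neg_zero]
    | ι y =>
      rw [← h]
      exact congrArg f (symBracket_ι k g x y)
    | mul a b ha hb => simp only [PoissonAlgebra.leibniz, map_add, map_mul, ha, hb]
    | add a b ha hb => simp only [map_add, ha, hb]
  intro a b
  -- Exchanging the arguments puts `a` in the slot where the Leibniz rule is available.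
  rw [bracket_skew, map_neg, bracket_skew (f a), neg_inj]
  induction a using SymmetricAlgebra.induction with
  | algebraMap r =>
    rw [bracket_skew, bracket_algebraMap_left, bracket_skew (f _), AlgHom.commutes,
      bracket_algebraMap_left, neg_zero, map_zero, neg_zero]
  | ι x => rw [bracket_skew, map_neg, hr, bracket_skew (f b)]
  | mul a b ha hb => simp only [PoissonAlgebra.leibniz, map_add, map_mul, ha, hb]
  | add a b ha hb => simp only [map_add, ha, hb]

/-! ### The natural map: construction, uniqueness, surjectivity, symmetrization. -/

section NaturalMap

variable (k : Type*) [Field k] (V : Type*) [AddCommGroup V] [Module k V]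

/-- The classes of elements of the various `L_n` fit into one linear map because the tensor degree
separates the `L_n`. Linear retractions of `TV` onto the subspaces `F_n` extend the symbol maps to
all of `TV`. -/
theorem exists_linearMap_symb : ∃ θ : TensorAlgebra k V →ₗ[k] Gr k (TensorAlgebra k V),
    ∀ n l (hl : l ∈ lieDeg k V n),
      θ l = symb k (TensorAlgebra k V) n ⟨l, lieDeg_le_commFil n hl⟩ := by
  have hq : ∀ n, ∃ q : TensorAlgebra k V →ₗ[k] commFil k (TensorAlgebra k V) n,
      q ∘ₗ (commFil k (TensorAlgebra k V) n).subtype = LinearMap.id := fun n =>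
    LinearMap.exists_leftInverse_of_injective _ (Submodule.ker_subtype _)
  choose q hq using hq
  -- `L_n` sits in tensor degree `m = n + 1`, whence `m - 1`; the truncated value at `m = 0` plays
  -- no role on the `L_n`.
  refine ⟨Polynomial.lsum (fun m => symb k (TensorAlgebra k V) (m - 1) ∘ₗ q (m - 1)) ∘ₗ
    (weight k V).toLinearMap, fun n l hl => ?_⟩
  have := LinearMap.congr_fun (hq n) ⟨l, lieDeg_le_commFil n hl⟩
  simp only [LinearMap.comp_apply, Submodule.subtype_apply, LinearMap.id_apply] at this
  simp [weight_of_mem_lieDeg hl, Polynomial.lsum_apply, this]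

/-- The linear map `LV → ⨁ F n / F (n + 1)` which sends `l` in `L_n` to its class
in `F n / F (n + 1)`. -/
noncomputable def lieSymb : freeLie k V →ₗ[k] Gr k (TensorAlgebra k V) :=
  (exists_linearMap_symb k V).choose ∘ₗ (freeLie k V).toSubmodule.subtype

/-- The natural map `Poiss V → ⨁ F n / F (n + 1)`. -/
noncomputable def naturalMap : Poiss k V →ₐ[k] Gr k (TensorAlgebra k V) :=
  SymmetricAlgebra.lift (lieSymb k V)

variable {k V}

theorem lieSymb_eq {n : ℕ} {l : freeLie k V} (hl : (l : TensorAlgebra k V) ∈ lieDeg k V n) :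
    lieSymb k V l = symb k (TensorAlgebra k V) n ⟨l, lieDeg_le_commFil n hl⟩ :=
  (exists_linearMap_symb k V).choose_spec n l hl

theorem naturalMap_lieToPoiss {n : ℕ} {l : freeLie k V}
    (hl : (l : TensorAlgebra k V) ∈ lieDeg k V n) :
    naturalMap k V (lieToPoiss k V l) =
      symb k (TensorAlgebra k V) n ⟨l, lieDeg_le_commFil n hl⟩ := by
  rw [naturalMap, SymmetricAlgebra.lift_ι_apply, lieSymb_eq hl]

theorem coe_freeLieGen_mem (v : V) :
    (freeLieGen k v : TensorAlgebra k V) ∈ lieDeg k V 0 := by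
  rw [lieDeg]
  exact ⟨v, rfl⟩

theorem naturalMap_freeLieGen (v : V) : naturalMap k V (lieToPoiss k V (freeLieGen k v)) =
    symb k (TensorAlgebra k V) 0 ⟨TensorAlgebra.ι k v, mem_commFil_zero _⟩ :=
  naturalMap_lieToPoiss (coe_freeLieGen_mem v)

theorem lieSymb_lie (x y : freeLie k V) :
    lieSymb k V ⁅x, y⁆ = grLie k (TensorAlgebra k V) (lieSymb k V x) (lieSymb k V y) := by
  induction x using freeLie_induction with
  | add x x' hx hx' => rw [add_lie, map_add, hx, hx', map_add, map_add, LinearMap.add_apply]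
  | homogeneous p x hx =>
    induction y using freeLie_induction with
    | add y y' hy hy' => rw [lie_add, map_add, hy, hy', map_add, map_add]
    | homogeneous q y hy =>
      rw [lieSymb_eq hx, lieSymb_eq hy, grLie_symb]
      exact lieSymb_eq (l := ⁅x, y⁆) (lie_mem_lieDeg hx hy)

theorem isPoissonHom_naturalMap : IsPoissonHom (naturalMap k V) := by
  refine isPoissonHom_of_ι _ fun x y => ?_
  simp only [naturalMap, SymmetricAlgebra.lift_ι_apply]
  exact lieSymb_lie x y

/-- `V` generates `S(LV)` as a Poisson algebra: `L_{n+1}` is spanned by the Poisson brackets of `V`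
with `L_n`, and `LV` generates `S(LV)` as an algebra. -/
theorem poissonHom_ext {Q : Type*} [CommRing Q] [Algebra k Q] [PoissonAlgebra k Q]
    {f g : Poiss k V →ₐ[k] Q} (hf : IsPoissonHom f) (hg : IsPoissonHom g)
    (h : ∀ v, f (lieToPoiss k V (freeLieGen k v)) = g (lieToPoiss k V (freeLieGen k v))) :
    f = g := by
  have key : ∀ n t (ht : t ∈ lieDeg k V n),
      f (lieToPoiss k V ⟨t, lieDeg_le_freeLie n ht⟩) =
        g (lieToPoiss k V ⟨t, lieDeg_le_freeLie n ht⟩) := by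
    intro n
    induction n with
    | zero =>
      intro t ht
      have ht' := ht
      rw [lieDeg] at ht'
      obtain ⟨v, rfl⟩ := ht'
      exact h v
    | succ n ih =>
      intro t ht
      have ht' := ht
      rw [lieDeg] at ht'
      induction ht' using Submodule.span_induction with
      | zero =>
        have e : (⟨0, lieDeg_le_freeLie _ ht⟩ : freeLie k V) = 0 := rfl
        rw [e]; simp only [map_zero]
      | add x y hx hy hx' hy' =>
        rw [← lieDeg] at hx hy
        have e : (⟨x + y, lieDeg_le_freeLie _ ht⟩ : freeLie k V) =
          ⟨x, lieDeg_le_freeLie _ hx⟩ + ⟨y, lieDeg_le_freeLie _ hy⟩ := rfl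
        rw [e]; simp only [map_add]; rw [hx' hx, hy' hy]
      | smul a x hx hx' =>
        rw [← lieDeg] at hx
        have e : (⟨a • x, lieDeg_le_freeLie _ ht⟩ : freeLie k V) =
          a • ⟨x, lieDeg_le_freeLie _ hx⟩ := rfl
        rw [e]; simp only [map_smul]; rw [hx' hx]
      | mem x hx =>
        obtain ⟨v, hv, l, hl, rfl⟩ := hx
        have hv' := hv
        rw [lieDeg] at hv'
        obtain ⟨v, rfl⟩ := hv'
        have e : lieToPoiss k V ⟨⁅TensorAlgebra.ι k v, l⁆, lieDeg_le_freeLie _ ht⟩ =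
          PoissonAlgebra.bracket (k := k) (lieToPoiss k V (freeLieGen k v))
            (lieToPoiss k V ⟨l, lieDeg_le_freeLie _ hl⟩) :=
            (symBracket_ι k (freeLie k V) (freeLieGen k v) ⟨l, lieDeg_le_freeLie _ hl⟩).symm
        rw [e, hf, hg, h, ih l hl]
  apply SymmetricAlgebra.algHom_ext
  ext l
  simp only [LinearMap.comp_apply]
  induction l using freeLie_induction with
  | homogeneous n l hl => exact key n l hl
  | add x y hx hy => simp only [map_add, hx, hy]

theorem LieProd.naturalMap_eq {r n : ℕ} {t : TensorAlgebra k V} {x : Poiss k V}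
    (h : LieProd k V r n t x) :
    naturalMap k V x = symb k (TensorAlgebra k V) n ⟨t, h.mem_commFil⟩ := by
  induction h with
  | one => exact map_one _
  | cons hl h ih => rw [map_mul, naturalMap_lieToPoiss hl, ih, symb_mul]

theorem map_poissDeg (n : ℕ) : (poissDeg k V n).map (naturalMap k V).toLinearMap =
    LinearMap.range (DirectSum.lof k ℕ (GrPiece k (TensorAlgebra k V)) n) := by
  apply le_antisymm
  · rw [poissDeg, Submodule.map_span, Submodule.span_le]
    rintro _ ⟨_, ⟨r, d, l, hl, rfl, rfl⟩, rfl⟩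
    exact ⟨_, (LieProd.ofFn d l hl).naturalMap_eq.symm⟩
  · rintro _ ⟨y, rfl⟩
    obtain ⟨a, ha, rfl⟩ := grMk_surj y
    change symb k (TensorAlgebra k V) n ⟨a, ha⟩ ∈ _
    have ha' := ha
    rw [commFil_tensorAlgebra] at ha'
    induction ha' using Submodule.span_induction with
    | zero =>
      have e : (⟨0, ha⟩ : commFil k (TensorAlgebra k V) n) = 0 := rfl
      rw [e, map_zero]; exact zero_mem _
    | add x y hx hy hx' hy' =>
      rw [← prodFil, ← commFil_tensorAlgebra] at hx hy
      have e : (⟨x + y, ha⟩ : commFil k (TensorAlgebra k V) n) = ⟨x, hx⟩ + ⟨y, hy⟩ := rfl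
      rw [e, map_add]; exact add_mem (hx' hx) (hy' hy)
    | smul a x hx hx' =>
      rw [← prodFil, ← commFil_tensorAlgebra] at hx
      have e : (⟨a • x, ha⟩ : commFil k (TensorAlgebra k V) n) = a • ⟨x, hx⟩ := rfl
      rw [e, map_smul]; exact Submodule.smul_mem _ _ (hx' hx)
    | mem t ht =>
      obtain ⟨r, m, x, hm, h⟩ := ht
      -- A product of degree exactly `n` is the image of its commutative counterpart; one of larger
      -- degree lies in `F_{n+1}` and has zero class.
      rcases hm.eq_or_lt with rfl | hm
      · exact ⟨x, h.mem_poissDeg, h.naturalMap_eq⟩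
      · have h0 : t ∈ commFil k (TensorAlgebra k V) (n + 1) := by
          rw [commFil_tensorAlgebra]; exact h.mem_prodFil hm
        have e : symb k (TensorAlgebra k V) n ⟨t, ha⟩ = 0 := by
          rw [symb, LinearMap.comp_apply, grMk_eq_zero ha h0, map_zero]
        rw [e]; exact zero_mem _

theorem naturalMap_surjective : Function.Surjective (naturalMap k V) := by
  intro y
  induction y using DirectSum.induction_on with
  | zero => exact ⟨0, map_zero _⟩
  | of n y =>
    have : DirectSum.lof k ℕ (GrPiece k (TensorAlgebra k V)) n y ∈
        (poissDeg k V n).map (naturalMap k V).toLinearMap := by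
      rw [map_poissDeg]; exact ⟨y, rfl⟩
    obtain ⟨x, _, hx⟩ := this
    exact ⟨x, hx⟩
  | add x y hx hy =>
    obtain ⟨x, rfl⟩ := hx
    obtain ⟨y, rfl⟩ := hy
    exact ⟨x + y, map_add _ _ _⟩

theorem naturalMap_symmetrized [CharZero k] {r : ℕ} (d : Fin r → ℕ) (l : Fin r → freeLie k V)
    (hl : ∀ i, (l i : TensorAlgebra k V) ∈ lieDeg k V (d i)) :
    ∃ h : symmetrized k (fun i => (l i : TensorAlgebra k V)) ∈
        commFil k (TensorAlgebra k V) (∑ i, d i),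
      naturalMap k V (∏ i, lieToPoiss k V (l i)) =
        symb k (TensorAlgebra k V) (∑ i, d i)
          ⟨symmetrized k (fun i => (l i : TensorAlgebra k V)), h⟩ := by
  -- All reorderings in `TV` correspond to the same commutative product, so their classes coincide
  -- and the average of the `r!` products has that class.
  have hp : ∀ σ : Equiv.Perm (Fin r), LieProd k V r (∑ i, d i)
      (List.ofFn fun i => (l (σ i) : TensorAlgebra k V)).prod (∏ i, lieToPoiss k V (l i)) := by
    intro σ
    have := LieProd.ofFn (fun i => d (σ i)) (fun i => l (σ i)) fun i => hl (σ i)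
    rwa [Equiv.sum_comp σ d, Equiv.prod_comp σ fun i => lieToPoiss k V (l i)] at this
  have hr : (r.factorial : k) ≠ 0 := by exact_mod_cast r.factorial_ne_zero
  -- Averaging inside `F_n` yields the membership and, by linearity of `symb`, the class.
  let T : Equiv.Perm (Fin r) → commFil k (TensorAlgebra k V) (∑ i, d i) := fun σ =>
    ⟨_, (hp σ).mem_commFil⟩
  have hs : (((r.factorial : k)⁻¹ • ∑ σ, T σ : commFil k (TensorAlgebra k V) (∑ i, d i)) :
      TensorAlgebra k V) = symmetrized k (fun i => (l i : TensorAlgebra k V)) := by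
    simp [symmetrized, T]
  refine ⟨hs ▸ Subtype.property _, ?_⟩
  have e : (⟨symmetrized k (fun i => (l i : TensorAlgebra k V)), hs ▸ Subtype.property _⟩ :
      commFil k (TensorAlgebra k V) (∑ i, d i)) = (r.factorial : k)⁻¹ • ∑ σ, T σ :=
    Subtype.ext hs.symm
  rw [e, map_smul, map_sum, Finset.sum_congr rfl fun σ _ => (hp σ).naturalMap_eq.symm,
    Finset.sum_const, Finset.card_univ, Fintype.card_perm, Fintype.card_fin,
    ← Nat.cast_smul_eq_nsmul k, smul_smul, inv_mul_cancel₀ hr, one_smul]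

end NaturalMap

/-! ### The coproduct of `TV` on products of primitive elements. -/

section Coproduct

variable (k : Type*) [CommRing k] (V : Type*) [AddCommGroup V] [Module k V]

/-- The coproduct of the tensor algebra for which the elements of `V` are primitive. -/
noncomputable def coproduct :
    TensorAlgebra k V →ₐ[k] TensorAlgebra k V ⊗[k] TensorAlgebra k V :=
  TensorAlgebra.lift k
    (((TensorProduct.mk k (TensorAlgebra k V) (TensorAlgebra k V)).flip 1 +
      TensorProduct.mk k (TensorAlgebra k V) (TensorAlgebra k V) 1) ∘ₗ TensorAlgebra.ι k)

variable {k V}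

theorem coproduct_of_mem_freeLie {l : TensorAlgebra k V} (hl : l ∈ freeLie k V) :
    coproduct k V l = l ⊗ₜ 1 + 1 ⊗ₜ l := by
  induction hl using LieSubalgebra.lieSpan_induction with
  | mem x h =>
    obtain ⟨v, rfl⟩ := h
    simp [coproduct]
  | zero => simp
  | add x y _ _ hx hy =>
    rw [map_add, hx, hy, TensorProduct.add_tmul, TensorProduct.tmul_add]
    abel
  | smul a x _ hx =>
    rw [map_smul, hx, smul_add, TensorProduct.smul_tmul', TensorProduct.tmul_smul]
  | lie x y _ _ hx hy =>
    rw [Ring.lie_def, map_sub, map_mul, map_mul, hx, hy]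
    simp only [mul_add, add_mul, Algebra.TensorProduct.tmul_mul_tmul, mul_one, one_mul,
      TensorProduct.sub_tmul, TensorProduct.tmul_sub]
    abel

theorem algebraMapInv_of_mem_freeLie {l : TensorAlgebra k V} (hl : l ∈ freeLie k V) :
    TensorAlgebra.algebraMapInv l = (0 : k) := by
  induction hl using LieSubalgebra.lieSpan_induction with
  | mem x h =>
    obtain ⟨v, rfl⟩ := h
    simp [TensorAlgebra.algebraMapInv]
  | zero => simp
  | add x y _ _ hx hy => rw [map_add, hx, hy, add_zero]
  | smul a x _ hx => rw [map_smul, hx, smul_zero]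
  | lie x y _ _ hx hy => rw [Ring.lie_def, map_sub, map_mul, map_mul, hx, hy]; simp

/-- The terms `l_i ⊗ l_1 ⋯ l_{i-1} l_{i+1} ⋯ l_r` of the coproduct of a product `l_1 ⋯ l_r` of
elements of `LV`; all other terms but `1 ⊗ l_1 ⋯ l_r` have a second factor of length at
most `r - 2`. -/
theorem LieProd.coproduct_eq {r n : ℕ} {t : TensorAlgebra k V} {x : Poiss k V}
    (h : LieProd k V r n t x) :
    ∃ (l : Fin r → freeLie k V) (u : Fin r → TensorAlgebra k V) (y : Fin r → Poiss k V),
      (∀ i, ∃ m, LieProd k V (r - 1) m (u i) (y i)) ∧ (∀ i, lieToPoiss k V (l i) * y i = x) ∧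
      coproduct k V t - 1 ⊗ₜ t - ∑ i, (l i : TensorAlgebra k V) ⊗ₜ[k] u i ∈
        Submodule.span k {z | ∃ s m a b w, s + 2 ≤ r ∧ LieProd k V s m b w ∧
          z = (a : TensorAlgebra k V) ⊗ₜ[k] b} := by
  induction h with
  | one =>
    refine ⟨Fin.elim0, Fin.elim0, Fin.elim0, fun i => i.elim0, fun i => i.elim0, ?_⟩
    simp [Algebra.TensorProduct.one_def]
  | @cons d r n m t x hm h ih =>
    obtain ⟨l, u, y, hu, hy, hs⟩ := ih
    -- In `(m ⊗ 1 + 1 ⊗ m) * Δ t`, the new term `m ⊗ t` comes from `(m ⊗ 1) * (1 ⊗ t)`, and `1 ⊗ m`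
    -- turns each `l_i ⊗ u_i` into `l_i ⊗ m u_i`.
    refine ⟨Fin.cons m l, Fin.cons t fun i => m * u i, Fin.cons x fun i => lieToPoiss k V m * y i,
      fun i => ?_, fun i => ?_, ?_⟩
    · induction i using Fin.cases with
      | zero => exact ⟨n, h⟩
      | succ i =>
        obtain ⟨e, he⟩ := hu i
        have := cons hm he
        rw [Nat.sub_add_cancel i.pos] at this
        exact ⟨_, this⟩
    · induction i using Fin.cases with
      | zero => rfl
      | succ i =>
        simp only [Fin.cons_succ]
        rw [← hy i]
        ring
    · rw [map_mul, coproduct_of_mem_freeLie m.2, Fin.sum_univ_succ]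
      simp only [Fin.cons_zero, Fin.cons_succ]
      set W := Submodule.span k {z | ∃ s e a b w, s + 2 ≤ r ∧ LieProd k V s e b w ∧
        z = (a : TensorAlgebra k V) ⊗ₜ[k] b}
      set W' := Submodule.span k {z | ∃ s e a b w, s + 2 ≤ r + 1 ∧ LieProd k V s e b w ∧
        z = (a : TensorAlgebra k V) ⊗ₜ[k] b}
      have h1 : ∀ z ∈ W, ((m : TensorAlgebra k V) ⊗ₜ[k] (1 : TensorAlgebra k V)) * z ∈ W' := by
        intro z hz
        induction hz using Submodule.span_induction with
        | zero => rw [mul_zero]; exact zero_mem _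
        | add a b _ _ ha hb => rw [mul_add]; exact add_mem ha hb
        | smul c a _ ha => rw [mul_smul_comm]; exact Submodule.smul_mem _ _ ha
        | mem z hz =>
          obtain ⟨s, e, a, b, w, hr, hb, rfl⟩ := hz
          rw [Algebra.TensorProduct.tmul_mul_tmul, one_mul]
          exact Submodule.subset_span ⟨s, e, _, b, w, by omega, hb, rfl⟩
      have h2 : ∀ z ∈ W, ((1 : TensorAlgebra k V) ⊗ₜ[k] (m : TensorAlgebra k V)) * z ∈ W' := by
        intro z hz
        induction hz using Submodule.span_induction with
        | zero => rw [mul_zero]; exact zero_mem _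
        | add a b _ _ ha hb => rw [mul_add]; exact add_mem ha hb
        | smul c a _ ha => rw [mul_smul_comm]; exact Submodule.smul_mem _ _ ha
        | mem z hz =>
          obtain ⟨s, e, a, b, w, hr, hb, rfl⟩ := hz
          rw [Algebra.TensorProduct.tmul_mul_tmul, one_mul]
          exact Submodule.subset_span ⟨_, _, _, _, _, by omega, cons hm hb, rfl⟩
      -- The terms `m l_i ⊗ u_i` join the remainder: `u_i` has length `r - 1`, two less than the new
      -- length `r + 1`.
      have h3 : ∑ i, ((m : TensorAlgebra k V) * l i) ⊗ₜ[k] u i ∈ W' := by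
        refine sum_mem fun i _ => ?_
        obtain ⟨e, he⟩ := hu i
        have := i.pos
        exact Submodule.subset_span ⟨_, e, _, _, _, by omega, he, rfl⟩
      have h4 := add_mem (add_mem (h1 _ hs) (h2 _ hs)) h3
      convert h4 using 1
      simp only [mul_sub, add_mul, Finset.mul_sum, Algebra.TensorProduct.tmul_mul_tmul, one_mul,
        mul_one]
      abel

end Coproduct

/-! ### Convolution powers of a projection onto `LV`. -/

section Polarization

variable {k : Type*} [CommRing k] {V : Type*} [AddCommGroup V] [Module k V]

/-- The `r`-th convolution power `TV → S(LV)` of the composition of a linear map `π : TV → LV` with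
the inclusion of `LV` in `S(LV)`. -/
noncomputable def convPow (π : TensorAlgebra k V →ₗ[k] freeLie k V) :
    ℕ → TensorAlgebra k V →ₗ[k] Poiss k V
  | 0 => Algebra.linearMap k (Poiss k V) ∘ₗ
      (TensorAlgebra.algebraMapInv (R := k) (M := V)).toLinearMap
  | r + 1 => LinearMap.mul' k (Poiss k V) ∘ₗ
      TensorProduct.map (lieToPoiss k V ∘ₗ π) (convPow π r) ∘ₗ (coproduct k V).toLinearMap

variable {π : TensorAlgebra k V →ₗ[k] freeLie k V}

/-- Inductive step for the next two lemmas: in the coproduct, the term `1 ⊗ t` dies by `π 1 = 0` and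
the terms with short second factor die by `hp`, so only those that split off a single `l_i` remain.
-/
theorem convPow_succ_of_lieProd (h1 : π 1 = 0) (hπ : ∀ l : freeLie k V, π l = l)
    {p r n : ℕ} {t : TensorAlgebra k V} {x : Poiss k V} (h : LieProd k V r n t x)
    (hp : ∀ s m u y, s + 2 ≤ r → LieProd k V s m u y → convPow π p u = 0) :
    ∃ (l : Fin r → freeLie k V) (u : Fin r → TensorAlgebra k V) (y : Fin r → Poiss k V),
      (∀ i, ∃ m, LieProd k V (r - 1) m (u i) (y i)) ∧ (∀ i, lieToPoiss k V (l i) * y i = x) ∧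
      convPow π (p + 1) t = ∑ i, lieToPoiss k V (l i) * convPow π p (u i) := by
  obtain ⟨l, u, y, hu, hy, hs⟩ := h.coproduct_eq
  refine ⟨l, u, y, hu, hy, ?_⟩
  set F := LinearMap.mul' k (Poiss k V) ∘ₗ TensorProduct.map (lieToPoiss k V ∘ₗ π) (convPow π p)
  have hFt : ∀ a b, F (a ⊗ₜ b) = lieToPoiss k V (π a) * convPow π p b := fun a b => rfl
  have key : ∀ z ∈ Submodule.span k {z | ∃ s m a b w, s + 2 ≤ r ∧ LieProd k V s m b w ∧
      z = (a : TensorAlgebra k V) ⊗ₜ[k] b}, F z = 0 := by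
    intro z hz
    induction hz using Submodule.span_induction with
    | zero => exact map_zero _
    | add a b _ _ ha hb => rw [map_add, ha, hb, add_zero]
    | smul c a _ ha => rw [map_smul, ha, smul_zero]
    | mem z hz =>
      obtain ⟨s, e, a, b, w, hr, hb, rfl⟩ := hz
      rw [hFt, hp s e b w hr hb, mul_zero]
  have := key _ hs
  rw [map_sub, map_sub, hFt, h1, map_zero, zero_mul, sub_zero, map_sum, sub_eq_zero] at this
  calc convPow π (p + 1) t = F (coproduct k V t) := rfl
    _ = _ := by simp only [this, hFt, hπ]

theorem convPow_eq_zero (h1 : π 1 = 0) (hπ : ∀ l : freeLie k V, π l = l) {p r n : ℕ}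
    {t : TensorAlgebra k V} {x : Poiss k V} (h : LieProd k V r n t x) (hr : r < p) :
    convPow π p t = 0 := by
  induction p generalizing r n t x with
  | zero => omega
  | succ p ih =>
    obtain ⟨l, u, y, hu, hy, e⟩ := convPow_succ_of_lieProd (p := p) h1 hπ h
      fun s m u y hs h' => ih h' (by omega)
    rw [e]
    refine Finset.sum_eq_zero fun i _ => ?_
    obtain ⟨m, hm⟩ := hu i
    have := i.pos
    rw [ih hm (by omega), mul_zero]

/-- Splitting off any one of the `r + 1` factors leaves a product of length `r`, which contributes
`r! • x` by induction; the sum is `(r + 1)! • x`. -/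
theorem convPow_lieProd (h1 : π 1 = 0) (hπ : ∀ l : freeLie k V, π l = l) {r n : ℕ}
    {t : TensorAlgebra k V} {x : Poiss k V} (h : LieProd k V r n t x) :
    convPow π r t = (r.factorial : k) • x := by
  induction r generalizing n t x with
  | zero =>
    cases h
    simp [convPow]
  | succ r ih =>
    obtain ⟨l, u, y, hu, hy, e⟩ := convPow_succ_of_lieProd (p := r) h1 hπ h
      fun s m u y hs h' => convPow_eq_zero h1 hπ h' (by omega)
    have : ∀ i, lieToPoiss k V (l i) * convPow π r (u i) = (r.factorial : k) • x := by
      intro i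
      obtain ⟨m, hm⟩ := hu i
      rw [ih hm, mul_smul_comm, hy]
    rw [e, Finset.sum_congr rfl fun i _ => this i, Finset.sum_const, Finset.card_univ,
      Fintype.card_fin, ← Nat.cast_smul_eq_nsmul k, smul_smul, Nat.factorial_succ, Nat.cast_mul]

end Polarization

/-! ### The left inverse of the natural map. -/

section Injectivity

variable (k : Type*) [Field k] (V : Type*) [AddCommGroup V] [Module k V]

theorem exists_projection_freeLie : ∃ π : TensorAlgebra k V →ₗ[k] freeLie k V,
    π 1 = 0 ∧ ∀ l : freeLie k V, π l = l := by
  obtain ⟨q, hq⟩ := LinearMap.exists_leftInverse_of_injective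
    (freeLie k V).toSubmodule.subtype (Submodule.ker_subtype _)
  -- The correction by the augmentation makes the value at `1` zero and changes nothing on `LV`,
  -- where the augmentation vanishes.
  refine ⟨q - (TensorAlgebra.algebraMapInv (R := k) (M := V)).toLinearMap.smulRight (q 1),
    by simp, fun l => ?_⟩
  have := LinearMap.congr_fun hq l
  simp only [LinearMap.comp_apply, Submodule.subtype_apply, LinearMap.id_apply] at this
  simp [algebraMapInv_of_mem_freeLie l.2, this]

variable {k V}

theorem exists_leftInverse_naturalMap [CharZero k] :
    ∃ ψ : Gr k (TensorAlgebra k V) →ₗ[k] Poiss k V, ∀ x, ψ (naturalMap k V x) = x := by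
  obtain ⟨π, h1, hπ⟩ := exists_projection_freeLie k V
  let ψ : ℕ → TensorAlgebra k V →ₗ[k] Poiss k V := fun n =>
    -- Here `m` is the tensor degree; for a product of Lie degree exactly `n`, the number `m - n` is
    -- its length.
    Polynomial.lsum (fun m => if n ≤ m then ((m - n).factorial : k)⁻¹ • convPow π (m - n) else 0) ∘ₗ
      (weight k V).toLinearMap
  have hψ : ∀ {n r m : ℕ} {t x}, n ≤ m → LieProd k V r m t x →
      ψ n t = ((m + r - n).factorial : k)⁻¹ • convPow π (m + r - n) t := by
    intro n r m t x hn h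
    simp [ψ, h.weight_eq, Polynomial.lsum_apply, show n ≤ m + r by omega]
  have h0 : ∀ n, ∀ t ∈ commFil k (TensorAlgebra k V) (n + 1), ψ n t = 0 := by
    intro n t ht
    rw [commFil_tensorAlgebra] at ht
    induction ht using Submodule.span_induction with
    | zero => exact map_zero _
    | add a b _ _ ha hb => rw [map_add, ha, hb, add_zero]
    | smul c a _ ha => rw [map_smul, ha, smul_zero]
    | mem t ht =>
      obtain ⟨r, m, x, hm, h⟩ := ht
      -- As `m ≥ n + 1`, the convolution exponent `m + r - n` exceeds the length `r`.
      rw [hψ (by omega) h, convPow_eq_zero h1 hπ h (by omega), smul_zero]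
  have h2 : ∀ {r n t x}, LieProd k V r n t x → ψ n t = x := by
    intro r n t x h
    have hr : (r.factorial : k) ≠ 0 := by exact_mod_cast r.factorial_ne_zero
    rw [hψ le_rfl h, Nat.add_sub_cancel_left, convPow_lieProd h1 hπ h, smul_smul,
      inv_mul_cancel₀ hr, one_smul]
  let Ψ : ∀ n, GrPiece k (TensorAlgebra k V) n →ₗ[k] Poiss k V := fun n =>
    Submodule.liftQ ((commFil k (TensorAlgebra k V) (n + 1)).submoduleOf
      (commFil k (TensorAlgebra k V) n))
      (ψ n ∘ₗ (commFil k (TensorAlgebra k V) n).subtype) fun t ht => h0 n t ht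
  refine ⟨DirectSum.toModule k ℕ _ Ψ, fun x => ?_⟩
  have hx : x ∈ Submodule.span k {x | ∃ r n t, LieProd k V r n t x} := by
    rw [span_lieProd]; trivial
  induction hx using Submodule.span_induction with
  | zero => simp only [map_zero]
  | add a b _ _ ha hb => simp only [map_add, ha, hb]
  | smul c a _ ha => simp only [map_smul, ha]
  | mem x hx =>
    obtain ⟨r, n, t, h⟩ := hx
    rw [h.naturalMap_eq, symb, LinearMap.comp_apply, DirectSum.toModule_lof]
    exact h2 h

theorem naturalMap_bijective [CharZero k] : Function.Bijective (naturalMap k V) := by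
  obtain ⟨ψ, hψ⟩ := exists_leftInverse_naturalMap (k := k) (V := V)
  exact ⟨Function.LeftInverse.injective hψ, naturalMap_surjective⟩

end Injectivity

end CommutatorFiltration

theorem corollary2p2 (k : Type*) [Field k] [CharZero k] (V : Type*) [AddCommGroup V]
    [Module k V] :
    ∃ φ : Poiss k V →ₐ[k] Gr k (TensorAlgebra k V),
      -- `φ` is the natural map: the unique homomorphism of Poisson algebras which sends `v` in `V`
      -- to its class in `F 0 / F 1`
      IsPoissonHom φ ∧
      (∀ v : V, φ (lieToPoiss k V (freeLieGen k v)) =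
        symb k (TensorAlgebra k V) 0 ⟨TensorAlgebra.ι k v, mem_commFil_zero _⟩) ∧
      (∀ ψ : Poiss k V →ₐ[k] Gr k (TensorAlgebra k V), IsPoissonHom ψ →
        (∀ v : V, ψ (lieToPoiss k V (freeLieGen k v)) =
          symb k (TensorAlgebra k V) 0 ⟨TensorAlgebra.ι k v, mem_commFil_zero _⟩) →
        ψ = φ) ∧
      -- it is an isomorphism
      Function.Bijective φ ∧
      -- of graded algebras
      (∀ n : ℕ, (poissDeg k V n).map φ.toLinearMap =
        LinearMap.range (DirectSum.lof k ℕ (GrPiece k (TensorAlgebra k V)) n)) ∧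
      -- and it is induced by the symmetrization map
      (∀ (r : ℕ) (d : Fin r → ℕ) (l : Fin r → freeLie k V),
        (∀ i, (l i : TensorAlgebra k V) ∈ lieDeg k V (d i)) →
        ∃ h : symmetrized k (fun i => (l i : TensorAlgebra k V)) ∈
            commFil k (TensorAlgebra k V) (∑ i, d i),
          φ (∏ i, lieToPoiss k V (l i)) =
            symb k (TensorAlgebra k V) (∑ i, d i)
              ⟨symmetrized k (fun i => (l i : TensorAlgebra k V)), h⟩) := by
  exact ⟨naturalMap k V, isPoissonHom_naturalMap, naturalMap_freeLieGen,
    fun ψ hψ h => poissonHom_ext hψ isPoissonHom_naturalMap fun v =>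
      (h v).trans (naturalMap_freeLieGen v).symm,
    naturalMap_bijective, map_poissDeg, fun r d l hl => naturalMap_symmetrized d l hl⟩
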